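/- **Theorem.** There is an absolute constant $C>0$ such that for all integers $n\ge 0$, $k\ge 1$, $t\ge 1$ there are a number of iterations $$T\le C\cdot\frac{t\log k}{\log(t+1)}$$ and sampling probabilities $p_0,p_1,\ldots\in[0,1]$ (both depending only on $n,k,t$) such that, for every simple graph $G$ on $n$ vertices with nonnegative edge weights and every fixed rule for breaking ties between edges of equal weight, the epoch-based algorithm described below with parameters $t$, $T$, $(p_i)$ has the following properties. * For every outcome of the random choices, its output $E_S$ is a spanner of $G$ of stretch at most $C\,k^{s}$, where $s=\frac{\log(2t+1)}{\log(t+1)}$; that is, $E_S\subseteq E(G)$ and $d_{(V,E_S)}(u,v)\le C k^s\, d_G(u,v)$ for all vertices $u,v$ (weighted distances). * $\mathbb E\,|E_S|\le C\, n^{1+1/k}\,(t+\log k)$. *The algorithm.* It performs $T$ growth iterations, grouped into epochs $i=0,1,\ldots$ of $t$ iterations each (only the last epoch may be shorter); each epoch ends with a contraction. It maintains a set $\mathsf E$ of unprocessed edges (initially $E(G)$), a set $E_S$ of spanner edges (initially empty), and a partition of some of the vertices into super-nodes (initially the singletons). At the start of an epoch every super-node is a cluster by itself. Write $\mathsf E(x,c)$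 for the unprocessed edges between a super-node (or vertex) $x$ and a cluster $c$; $x$ and $c$ are adjacent if it is nonempty. * *Growth iteration in epoch $i$.* Sample each current cluster independently with probability $p_i$. Simultaneously, each super-node $x$ in no sampled cluster does the following. If some sampled cluster is adjacent to $x$, let $c_0$ be the closest one (the one with the lightest edge to $x$) and let $e$ be the lightest edge of $\mathsf E(x,c_0)$; then $x$ joins $c_0$, and for $c=c_0$ and for each cluster $c$ having an edge to $x$ strictly lighter than $e$, the lightest edge of $\mathsf E(x,c)$ is added to $E_S$ and all of $\mathsf E(x,c)$ is discarded from $\mathsf E$. If no sampled cluster is adjacent to $x$, the same is done for every cluster $c$ adjacent to $x$, and $x$ is dropped. The new clusters are the sampled clusters together with the super-nodes that joined them; edges inside a new cluster are discarded from $\mathsf E$. * *Contraction.* The current clusters become the super-nodes, and between any two of them only the lightest edge of $\mathsf E$ is kept. * *Final phase.* After the last iteration, for every vertex $v$ of $G$ and every remaining cluster $c$ with $\mathsf E(v,c)\neq\emptyset$, the lightest edge of $\mathsf E(v,c)$ is added to $E_S$. -/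

import Mathlib

open scoped NNReal ENNReal

namespace EpochSpanner

/-! ### Weighted graphs and spanners -/

/-- Total weight of a walk; `w e` is the weight of the edge `e`. -/
def walkWeight {V : Type*} {G : SimpleGraph V} (w : Sym2 V → ℝ≥0) {u v : V}
    (q : G.Walk u v) : ℝ≥0 :=
  (q.edges.map w).sum

/-- Weighted distance: the infimum of the weights of the walks from `u` to `v`
(`∞` if there is none). -/
noncomputable def wdist {V : Type*} (G : SimpleGraph V) (w : Sym2 V → ℝ≥0) (u v : V) : ℝ≥0∞ :=
  ⨅ q : G.Walk u v, (walkWeight w q : ℝ≥0∞)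

/-- The edge set `S` is a spanner of the weighted graph `(G, w)` of stretch `r`: the graph `(V, S)`
is a subgraph of `G`, and its distances are at most `r` times those of `G`. -/
def IsSpanner {V : Type*} (G : SimpleGraph V) (w : Sym2 V → ℝ≥0) (r : ℝ) (S : Set (Sym2 V)) :
    Prop :=
  S ⊆ G.edgeSet ∧
    ∀ u v : V, wdist (SimpleGraph.fromEdgeSet S) w u v ≤ ENNReal.ofReal r * wdist G w u v

/-- `e` is at most as heavy as `f`, ties in the weight being broken by the numbering `rank`. -/
def Lighter {V : Type*} (w : Sym2 V → ℝ≥0) (rank : Sym2 V → ℕ) (e f : Sym2 V) : Prop :=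
  w e < w f ∨ (w e = w f ∧ rank e ≤ rank f)

/-- The set whose only element is the lowest weight edge of `A` (empty if `A` is). -/
def lightest {V : Type*} (w : Sym2 V → ℝ≥0) (rank : Sym2 V → ℕ) (A : Set (Sym2 V)) :
    Set (Sym2 V) :=
  {e | e ∈ A ∧ ∀ f ∈ A, Lighter w rank e f}

/-! ### The state of the algorithm -/

/-- A state of the algorithm. Super-nodes and clusters are named by their centers, which are
vertices of the input graph.
* `node v` is the super-node of the current quotient graph that contains the vertex `v`
  (`none` if `v` is in no super-node any more);
* `clus x` is the cluster that contains the super-node `x` in the current clustering of the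
  quotient graph (`none` if there is none);
* `edges` is the set of unprocessed edges, as edges of the input graph;
* `span` is the set of spanner edges chosen so far. -/
structure State (V : Type*) where
  node : V → Option V
  clus : V → Option V
  edges : Set (Sym2 V)
  span : Set (Sym2 V)

/-- Singleton super-nodes, singleton clusters, all edges unprocessed, no spanner edge. -/
def State.init {V : Type*} (G : SimpleGraph V) : State V where
  node := fun v => some v
  clus := fun x => some x
  edges := G.edgeSet
  span := ∅

/-- The current cluster that contains the vertex `v` of the input graph. -/
def State.clusterOf {V : Type*} (st : State V) (v : V) : Option V :=
  (st.node v).bind st.clus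

/-- The unprocessed edges between the super-node `x` and the cluster `c`. The cluster `c` is
adjacent to `x` if this set is nonempty. -/
def State.edgesTo {V : Type*} (st : State V) (x c : V) : Set (Sym2 V) :=
  {e | e ∈ st.edges ∧ ∃ u v : V, e = s(u, v) ∧ st.node u = some x ∧ st.clusterOf v = some c}

/-! ### One growth iteration

In all of the following, `R` is the set of the sampled centers: the sampled clusters are the current
clusters with center in `R`. All super-nodes act in parallel, on the state at the beginning of the
iteration. -/

/-- The super-node `x` lies in a sampled cluster. -/
def State.InSampled {V : Type*} (st : State V) (R : Finset V) (x : V) : Prop :=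
  ∃ c ∈ R, st.clus x = some c

/-- `c` is the closest sampled cluster adjacent to the super-node `x`. -/
def State.IsClosest {V : Type*} (w : Sym2 V → ℝ≥0) (rank : Sym2 V → ℕ) (st : State V)
    (R : Finset V) (x c : V) : Prop :=
  c ∈ R ∧ ∃ e ∈ st.edgesTo x c, ∀ c' ∈ R, ∀ f ∈ st.edgesTo x c', Lighter w rank e f

open Classical in
/-- The closest sampled cluster adjacent to `x`, `none` if no sampled cluster is adjacent to `x`. -/
noncomputable def State.closest {V : Type*} (w : Sym2 V → ℝ≥0) (rank : Sym2 V → ℕ) (st : State V)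
    (R : Finset V) (x : V) : Option V :=
  if h : ∃ c, st.IsClosest w rank R x c then some h.choose else none

/-- The super-node `x`, which is in no sampled cluster, settles its edges to the cluster `c`.
If some sampled cluster is adjacent to `x`, this is done for the closest one, `c₀`, and for the
clusters that have an edge to `x` strictly lighter than all edges between `x` and `c₀`;
otherwise it is done for all clusters. -/
def State.Settles {V : Type*} (w : Sym2 V → ℝ≥0) (rank : Sym2 V → ℕ) (st : State V)
    (R : Finset V) (x c : V) : Prop :=
  ¬ st.InSampled R x ∧
    ∀ c₀, st.closest w rank R x = some c₀ →
      c = c₀ ∨ ∃ e ∈ st.edgesTo x c, ∀ f ∈ st.edgesTo x c₀, w e < w f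

open Classical in
/-- The clustering after the iteration: super-nodes of sampled clusters stay, every other super-node
joins the closest sampled cluster adjacent to it, and is in no cluster any more if there is none. -/
noncomputable def State.newClus {V : Type*} (w : Sym2 V → ℝ≥0) (rank : Sym2 V → ℕ) (st : State V)
    (R : Finset V) (x : V) : Option V :=
  if st.InSampled R x then st.clus x else st.closest w rank R x

/-- One cluster-vertex growth iteration. Where `x` settles its edges to `c`, the lowest weight edge
between `x` and `c` enters the spanner and all edges between `x` and `c` are discarded. Finally the
edges inside the new clusters are discarded. -/
noncomputable def State.grow {V : Type*} (w : Sym2 V → ℝ≥0) (rank : Sym2 V → ℕ) (st : State V)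
    (R : Finset V) : State V where
  node := st.node
  clus := st.newClus w rank R
  edges := {e | e ∈ st.edges ∧ (∀ x c, st.Settles w rank R x c → e ∉ st.edgesTo x c) ∧
    ¬ ∃ c, ∀ v ∈ e, (st.node v).bind (st.newClus w rank R) = some c}
  span := st.span ∪ {e | ∃ x c, st.Settles w rank R x c ∧ e ∈ lightest w rank (st.edgesTo x c)}

/-! ### Contraction and the second phase -/

/-- End of an epoch: the clusters become the super-nodes, each of them a singleton cluster, and only
the lowest weight edge between any two of the new super-nodes is kept. -/
def State.contract {V : Type*} (w : Sym2 V → ℝ≥0) (rank : Sym2 V → ℕ) (st : State V) :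
    State V where
  node := st.clusterOf
  clus := fun x => some x
  edges := {e | e ∈ lightest w rank
    {f | f ∈ st.edges ∧ Sym2.map st.clusterOf f = Sym2.map st.clusterOf e}}
  span := st.span

/-- Second phase: for every vertex `v` of the input graph and every remaining cluster `c`, the
lowest weight edge between `v` and `c` enters the spanner. -/
def State.finish {V : Type*} (w : Sym2 V → ℝ≥0) (rank : Sym2 V → ℕ) (st : State V) :
    Set (Sym2 V) :=
  st.span ∪ {e | ∃ v c : V, e ∈ lightest w rank
    {f | f ∈ st.edges ∧ ∃ u : V, f = s(v, u) ∧ st.clusterOf u = some c}}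

/-! ### The algorithm -/

open Classical in
/-- The state after the first `m` of `T` growth iterations, where `R j` is the set of centers
sampled in iteration `j` (counted from `0`). An epoch consists of `t` iterations, only the last one
may be shorter; each epoch ends with a contraction. -/
noncomputable def stateAfter {V : Type*} (G : SimpleGraph V) (w : Sym2 V → ℝ≥0)
    (rank : Sym2 V → ℕ) (t T : ℕ) (R : ℕ → Finset V) : ℕ → State V
  | 0 => State.init G
  | m + 1 =>
    let st := (stateAfter G w rank t T R m).grow w rank (R m)
    if t ∣ m + 1 ∨ m + 1 = T then st.contract w rank else st

open Classical in
/-- The output of the algorithm with `T` growth iterations, if the samples are `R`. -/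
noncomputable def output {V : Type*} (G : SimpleGraph V) (w : Sym2 V → ℝ≥0)
    (rank : Sym2 V → ℕ) (t T : ℕ) (R : Fin T → Finset V) : Set (Sym2 V) :=
  (stateAfter G w rank t T (fun m => if h : m < T then R ⟨m, h⟩ else ∅) T).finish w rank

/-- Probability of the samples `R`, if each center is sampled independently, with probability `p i`
in each iteration of epoch `i` (counted from `0`; iteration `m` belongs to epoch `m / t`). The coins
of vertices that are not the center of a cluster have no effect on the algorithm. -/
noncomputable def sampleProb {V : Type*} [Fintype V] (t T : ℕ) (p : ℕ → ℝ)
    (R : Fin T → Finset V) : ℝ :=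
  ∏ m : Fin T, p (m / t) ^ (R m).card * (1 - p (m / t)) ^ (Fintype.card V - (R m).card)

/-- Expected number of edges of the output. -/
noncomputable def expectedSize {V : Type*} [Fintype V] (G : SimpleGraph V) (w : Sym2 V → ℝ≥0)
    (rank : Sym2 V → ℕ) (t T : ℕ) (p : ℕ → ℝ) : ℝ :=
  ∑ R : Fin T → Finset V, sampleProb t T p R * ((output G w rank t T R).ncard : ℝ)

end EpochSpanner

/-! Stretch. Radii are measured relative to unprocessed edges: if `e` is unprocessed, each endpoint
is within `r₀ * w e` of the center of its super-node and within `r * w e` of the center of its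
cluster. A super-node joins a cluster along an edge no heavier than any of its surviving edges, so a
growth iteration sends `r` to `r + 2 * r₀ + 1` (`Good.grow`). After `t` iterations `2 * r + 1 = (2 *
t + 1) * (2 * r₀ + 1)`, and a contraction makes `r` the new `r₀` (`Good.contract`). Hence `2 * r +
1` is multiplied by `2 * t + 1` per full epoch and by `2 * a + 1` for a last epoch of `a`
iterations. The other half of the invariant `Good` says that every edge of `G` is spanned or has a
nearby unprocessed substitute that is no heavier. So the final phase spans every edge of `G` with
stretch at most `8 * r + 1` (`Good.finish`), for every outcome of the coins.

Size. Order the clusters adjacent to a super-node by their lightest edges. An edge to a cluster is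
bought only if no earlier cluster is sampled, so the expected number of purchases is a geometric
sum, at most `1 / p` (`State.sum_coin_card_settled_le`). The center of a super-node in epoch `i` was
sampled in every iteration of the earlier epochs, and the current coins are independent of that.
This bounds the expected cost of an iteration by `n` times the product of the earlier epochs'
probabilities, divided by `p i`; the final phase costs at most `n` per surviving center
(`expectedSize_le`).

Parameters. Put `b = n ^ (-1/k)` and `p i = b ^ ((t + 1) ^ i) / 2`. The exponents of `b` over the
first `i` epochs add up to `(t + 1) ^ i - 1`, so one iteration of epoch `i` costs at most `2 * n / b
= 2 * n ^ (1 + 1/k)`, times a power of `1/2` that decays with `i`. The sum over all iterations is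
therefore `O(t * n ^ (1 + 1/k))`, without the `log k` term that the theorem allows. The algorithm
stops once the exponents sum to at least `k - 1`, which makes the final phase cost at most `n / b`.
-/

namespace EpochSpanner

/-! ### Short walks in the spanner -/

variable {V : Type*}

/-- Some walk from `u` to `v` along edges of `S` has weight at most `r * a`. -/
def Near (w : Sym2 V → ℝ≥0) (S : Set (Sym2 V)) (r : ℕ) (a : ℝ≥0) (u v : V) : Prop :=
  ∃ q : (SimpleGraph.fromEdgeSet S).Walk u v, walkWeight w q ≤ r * a

namespace Near

variable {w : Sym2 V → ℝ≥0} {S S' : Set (Sym2 V)} {r r' : ℕ} {a a' : ℝ≥0} {u v x : V}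

lemma refl (u : V) : Near w S r a u u := ⟨.nil, by simp [walkWeight]⟩

lemma symm (h : Near w S r a u v) : Near w S r a v u := by
  obtain ⟨q, hq⟩ := h
  exact ⟨q.reverse, by simpa [walkWeight, SimpleGraph.Walk.edges_reverse] using hq⟩

lemma trans (h : Near w S r a u x) (h' : Near w S r' a x v) : Near w S (r + r') a u v := by
  obtain ⟨q, hq⟩ := h
  obtain ⟨q', hq'⟩ := h'
  refine ⟨q.append q', ?_⟩
  have : walkWeight w (q.append q') = walkWeight w q + walkWeight w q' := by
    simp [walkWeight, SimpleGraph.Walk.edges_append]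
  rw [this, Nat.cast_add, add_mul]
  exact add_le_add hq hq'

lemma mono (h : Near w S r a u v) (hS : S ⊆ S') (hr : r ≤ r') (ha : a ≤ a') :
    Near w S' r' a' u v := by
  obtain ⟨q, hq⟩ := h
  refine ⟨q.mapLe (SimpleGraph.fromEdgeSet_mono hS), ?_⟩
  have : walkWeight w (q.mapLe (SimpleGraph.fromEdgeSet_mono hS)) = walkWeight w q := by
    simp [walkWeight, SimpleGraph.Walk.mapLe, SimpleGraph.Walk.edges_map]
  rw [this]
  exact hq.trans (by gcongr)

lemma of_mem (h : s(u, v) ∈ S) : Near w S 1 (w s(u, v)) u v := by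
  by_cases huv : u = v
  · subst huv; exact refl _
  · exact ⟨SimpleGraph.Walk.cons (by simp [h, huv]) .nil, by simp [walkWeight]⟩

end Near

/-! ### Stretch: the invariant and its preservation -/

section Stretch

variable [Finite V] {G : SimpleGraph V} {w : Sym2 V → ℝ≥0} {rank : Sym2 V → ℕ}

omit [Finite V] in
lemma lighter_iff {e f : Sym2 V} :
    Lighter w rank e f ↔ toLex (w e, rank e) ≤ toLex (w f, rank f) := by
  simp [Lighter, Prod.Lex.le_iff]

omit [Finite V] in
lemma Lighter.weight_le {e f : Sym2 V} (h : Lighter w rank e f) : w e ≤ w f := by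
  rcases h with h | h
  exacts [h.le, h.1.le]

lemma exists_mem_lightest {A : Set (Sym2 V)} (hA : A.Nonempty) :
    ∃ e, e ∈ lightest w rank A := by
  obtain ⟨e, he, h⟩ := A.toFinite.exists_minimalFor (fun e => toLex (w e, rank e)) A hA
  refine ⟨e, he, fun f hf => lighter_iff.2 ?_⟩
  rcases le_total (toLex (w e, rank e)) (toLex (w f, rank f)) with h' | h'
  exacts [h', h hf h']

omit [Finite V] in
lemma State.closest_spec {st : State V} {R : Finset V} {x c : V}
    (h : st.closest w rank R x = some c) : st.IsClosest w rank R x c := by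
  unfold State.closest at h
  split_ifs at h with h'
  rw [← Option.some.inj h]
  exact h'.choose_spec

/-- The invariant of the algorithm: seen from an unprocessed edge `e`, super-nodes have radius
at most `r₀ * w e` and clusters have radius at most `r * w e`; every edge of `G` is either spanned
already or represented by an unprocessed edge nearby. -/
structure Good (G : SimpleGraph V) (w : Sym2 V → ℝ≥0) (r₀ r : ℕ) (st : State V) : Prop where
  span_sub : st.span ⊆ G.edgeSet
  edges_sub : st.edges ⊆ G.edgeSet
  radius : ∀ u v, s(u, v) ∈ st.edges → ∃ x c, st.node u = some x ∧ st.clus x = some c ∧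
    Near w st.span r₀ (w s(u, v)) u x ∧ Near w st.span r (w s(u, v)) u c
  rep : ∀ u v, s(u, v) ∈ G.edgeSet → Near w st.span (4 * r) (w s(u, v)) u v ∨
    ∃ u' v', s(u', v') ∈ st.edges ∧ w s(u', v') ≤ w s(u, v) ∧
      Near w st.span (3 * r₀) (w s(u, v)) u u' ∧ Near w st.span (3 * r₀) (w s(u, v)) v v'

omit [Finite V] in
lemma good_init : Good G w 0 0 (State.init G) where
  span_sub := by simp [State.init]
  edges_sub := by simp [State.init]
  radius u v _ := ⟨u, u, rfl, rfl, .refl _, .refl _⟩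
  rep u v h := Or.inr ⟨u, v, h, le_rfl, .refl _, .refl _⟩

namespace Good

variable {r₀ r : ℕ} {st : State V} {R : Finset V}

omit [Finite V] in
lemma exists_clusterOf (h : Good G w r₀ r st) {u v : V} (he : s(u, v) ∈ st.edges) :
    ∃ c, st.clusterOf u = some c ∧ Near w st.span r (w s(u, v)) u c := by
  obtain ⟨x, c, hx, hc, -, h2⟩ := h.radius u v he
  exact ⟨c, by simp [State.clusterOf, hx, hc], h2⟩

/-- The edge `s(a, b)` bought between `x` and `c` is no heavier than the discarded one. The detour
runs from `u` to the center `x`, on to `a`, across to `b`, to the center `c`, and to `v`, with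
lengths `r₀ + r₀ + 1 + r + r`. -/
lemma near_of_settles (h : Good G w r₀ r st) {x c u v : V} (hs : st.Settles w rank R x c)
    (he : s(u, v) ∈ st.edges) (hu : st.node u = some x) (hv : st.clusterOf v = some c) :
    Near w (st.grow w rank R).span (2 * r₀ + 2 * r + 1) (w s(u, v)) u v := by
  have hmem : s(u, v) ∈ st.edgesTo x c := ⟨he, u, v, rfl, hu, hv⟩
  obtain ⟨e, he'⟩ := exists_mem_lightest (w := w) (rank := rank) ⟨_, hmem⟩
  have hsp : e ∈ (st.grow w rank R).span := Or.inr ⟨x, c, hs, he'⟩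
  have hle := (he'.2 _ hmem).weight_le
  obtain ⟨hel, a, b, rfl, ha, hb⟩ := he'.1
  have hss : st.span ⊆ (st.grow w rank R).span := Set.subset_union_left
  obtain ⟨x1, c1, hx1, -, hn1, -⟩ := h.radius u v he
  obtain ⟨x2, c2, hx2, -, hn2, -⟩ := h.radius a b hel
  obtain ⟨c3, hc3, hn3⟩ := h.exists_clusterOf (Sym2.eq_swap ▸ he : s(v, u) ∈ st.edges)
  obtain ⟨c4, hc4, hn4⟩ := h.exists_clusterOf (Sym2.eq_swap ▸ hel : s(b, a) ∈ st.edges)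
  obtain rfl : x1 = x := Option.some.inj (hx1.symm.trans hu)
  obtain rfl : x2 = x1 := Option.some.inj (hx2.symm.trans ha)
  obtain rfl : c3 = c := Option.some.inj (hc3.symm.trans hv)
  obtain rfl : c4 = c3 := Option.some.inj (hc4.symm.trans hb)
  rw [Sym2.eq_swap] at hn3 hn4
  have hn5 := (Near.of_mem (w := w) hsp).mono subset_rfl le_rfl hle
  exact ((((hn1.mono hss le_rfl le_rfl).trans (hn2.mono hss le_rfl hle).symm).trans hn5).trans
    ((hn4.mono hss le_rfl hle).trans (hn3.mono hss le_rfl le_rfl).symm)).mono subset_rfl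
      (by omega) le_rfl

/-- An edge at an unsampled super-node `x` survives settling only if `x` joins some `c₀` and the
edge is at least as heavy as the joining edge `s(a, b)`. The walk from `u` through `x`, `a` and `b`
to `c₀` then has length `r₀ + r₀ + 1 + r` in units of the surviving edge. -/
lemma newClus_of_not_settles (h : Good G w r₀ r st) {u v : V} (he : s(u, v) ∈ st.edges)
    (hs : ∀ x c, st.Settles w rank R x c → s(u, v) ∉ st.edgesTo x c) :
    ∃ x c, st.node u = some x ∧ st.newClus w rank R x = some c ∧
      Near w (st.grow w rank R).span r₀ (w s(u, v)) u x ∧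
      Near w (st.grow w rank R).span (r + 2 * r₀ + 1) (w s(u, v)) u c := by
  have hss : st.span ⊆ (st.grow w rank R).span := Set.subset_union_left
  obtain ⟨x, c, hx, hc, hn0, hn⟩ := h.radius u v he
  by_cases hin : st.InSampled R x
  · exact ⟨x, c, hx, by simp [State.newClus, hin, hc], hn0.mono hss le_rfl le_rfl,
      hn.mono hss (by omega) le_rfl⟩
  obtain ⟨c', hc', -⟩ := h.exists_clusterOf (Sym2.eq_swap ▸ he : s(v, u) ∈ st.edges)
  have hmem : s(u, v) ∈ st.edgesTo x c' := ⟨he, u, v, rfl, hx, hc'⟩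
  have hns : ¬ st.Settles w rank R x c' := fun h' => hs _ _ h' hmem
  simp only [State.Settles, hin, not_false_eq_true, true_and, not_forall, not_or, not_exists,
    not_and] at hns
  obtain ⟨c₀, hc₀, -, hlt⟩ := hns
  obtain ⟨f, hf, hfle⟩ := hlt _ hmem
  obtain ⟨e, he'⟩ := exists_mem_lightest (w := w) (rank := rank) ⟨_, hf⟩
  have hle : w e ≤ w s(u, v) := (he'.2 _ hf).weight_le.trans (not_lt.1 hfle)
  have hset : st.Settles w rank R x c₀ :=
    ⟨hin, fun c₁ h₁ => Or.inl (Option.some.inj (hc₀.symm.trans h₁))⟩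
  have hsp : e ∈ (st.grow w rank R).span := Or.inr ⟨x, c₀, hset, he'⟩
  obtain ⟨hel, a, b, rfl, ha, hb⟩ := he'.1
  obtain ⟨x2, c2, hx2, -, hn2, -⟩ := h.radius a b hel
  obtain ⟨c4, hc4, hn4⟩ := h.exists_clusterOf (Sym2.eq_swap ▸ hel : s(b, a) ∈ st.edges)
  obtain rfl : x2 = x := Option.some.inj (hx2.symm.trans ha)
  obtain rfl : c4 = c₀ := Option.some.inj (hc4.symm.trans hb)
  rw [Sym2.eq_swap] at hn4
  refine ⟨x2, c4, hx, by simp [State.newClus, hin, hc₀], hn0.mono hss le_rfl le_rfl, ?_⟩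
  exact ((((hn0.mono hss le_rfl le_rfl).trans (hn2.mono hss le_rfl hle).symm).trans
    ((Near.of_mem (w := w) hsp).mono subset_rfl le_rfl hle)).trans
    (hn4.mono hss le_rfl hle)).mono subset_rfl (by omega) le_rfl

lemma grow (h : Good G w r₀ r st) (hr : r₀ ≤ r) :
    Good G w r₀ (r + 2 * r₀ + 1) (st.grow w rank R) := by
  have hss : st.span ⊆ (st.grow w rank R).span := Set.subset_union_left
  refine ⟨?_, fun e he => h.edges_sub he.1, fun u v he => ?_, fun u v he => ?_⟩
  · rintro e (he | ⟨x, c, -, he⟩)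
    exacts [h.span_sub he, h.edges_sub he.1.1]
  · exact h.newClus_of_not_settles he.1 he.2.1
  rcases h.rep u v he with h1 | ⟨u', v', hl, hle, hu, hv⟩
  · exact Or.inl (h1.mono hss (by omega) le_rfl)
  have hu' := hu.mono hss le_rfl le_rfl
  have hv' := hv.mono hss le_rfl le_rfl
  -- It suffices to treat the representative: reaching it from both ends costs `6 * r₀`, and `6 * r₀
  -- + 2 * (r + 2 * r₀ + 1) ≤ 4 * (r + 2 * r₀ + 1)` because `r₀ ≤ r`.
  suffices hS : Near w (st.grow w rank R).span (2 * (r + 2 * r₀ + 1)) (w s(u', v')) u' v' ∨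
      s(u', v') ∈ (st.grow w rank R).edges by
    rcases hS with hS | hS
    · exact Or.inl (((hu'.trans (hS.mono subset_rfl le_rfl hle)).trans hv'.symm).mono subset_rfl
        (by omega) le_rfl)
    · exact Or.inr ⟨u', v', hS, hle, hu', hv'⟩
  by_cases hs : ∀ x c, st.Settles w rank R x c → s(u', v') ∉ st.edgesTo x c
  · by_cases hc : ∃ c, ∀ z ∈ s(u', v'), (st.node z).bind (st.newClus w rank R) = some c
    · left
      obtain ⟨c, hc⟩ := hc
      obtain ⟨x1, c1, hx1, hc1, -, hn1⟩ := h.newClus_of_not_settles hl hs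
      obtain ⟨x2, c2, hx2, hc2, -, hn2⟩ := h.newClus_of_not_settles
        (Sym2.eq_swap ▸ hl : s(v', u') ∈ st.edges) (by rwa [Sym2.eq_swap])
      have e1 := hc u' (by simp)
      have e2 := hc v' (by simp)
      rw [hx1, Option.bind_some, hc1] at e1
      rw [hx2, Option.bind_some, hc2] at e2
      obtain rfl := Option.some.inj e1
      obtain rfl := Option.some.inj e2
      rw [Sym2.eq_swap] at hn2
      exact (hn1.trans hn2.symm).mono subset_rfl (by omega) le_rfl
    · exact Or.inr ⟨hl, hs, hc⟩
  · left
    push Not at hs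
    obtain ⟨x, c, hset, -, a, b, hab, ha, hb⟩ := hs
    have hn := h.near_of_settles hset (hab ▸ hl) ha hb
    rcases Sym2.eq_iff.1 hab with ⟨rfl, rfl⟩ | ⟨rfl, rfl⟩
    · exact hn.mono subset_rfl (by omega) le_rfl
    · rw [Sym2.eq_swap]
      exact hn.symm.mono subset_rfl (by omega) le_rfl

/-- A discarded parallel edge is replaced by the kept one, which joins the same two clusters and is
no heavier. Each endpoint moves through its cluster center at cost `2 * r`, so its distance to the
representative becomes `3 * r₀ + 2 * r ≤ 3 * r`. -/
lemma contract (h : Good G w r₀ r st) (hr : 3 * r₀ ≤ r) : Good G w r r (st.contract w rank) := by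
  refine ⟨h.span_sub, fun e he => h.edges_sub he.1.1, fun u v he => ?_, fun u v he => ?_⟩
  · obtain ⟨c, hc, hn⟩ := h.exists_clusterOf he.1.1
    exact ⟨c, c, hc, rfl, hn, hn⟩
  rcases h.rep u v he with h1 | ⟨u', v', hl, hle, hu, hv⟩
  · exact Or.inl h1
  right
  obtain ⟨f, hf⟩ := exists_mem_lightest (w := w) (rank := rank) (A := {f | f ∈ st.edges ∧
    Sym2.map st.clusterOf f = Sym2.map st.clusterOf s(u', v')}) ⟨_, hl, rfl⟩
  have hfe : f ∈ (st.contract w rank).edges := by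
    have := hf.1.2
    simpa [State.contract, this] using hf
  have hlf := (hf.2 _ ⟨hl, rfl⟩).weight_le
  obtain ⟨⟨hfl, hmap⟩, -⟩ := hf
  obtain ⟨c1, hc1, hn1⟩ := h.exists_clusterOf hl
  obtain ⟨c2, hc2, hn2⟩ := h.exists_clusterOf (Sym2.eq_swap ▸ hl : s(v', u') ∈ st.edges)
  rw [Sym2.eq_swap] at hn2
  obtain ⟨a, b, rfl, ha, hb⟩ : ∃ a b, f = s(a, b) ∧ st.clusterOf a = some c1 ∧
      st.clusterOf b = some c2 := by
    induction f with | _ a b =>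
    rw [Sym2.map_mk, Sym2.map_mk, Sym2.eq_iff, hc1, hc2] at hmap
    rcases hmap with ⟨h1, h2⟩ | ⟨h1, h2⟩
    exacts [⟨a, b, rfl, h1, h2⟩, ⟨b, a, Sym2.eq_swap, h2, h1⟩]
  obtain ⟨c3, hc3, hn3⟩ := h.exists_clusterOf hfl
  obtain ⟨c4, hc4, hn4⟩ := h.exists_clusterOf (Sym2.eq_swap ▸ hfl : s(b, a) ∈ st.edges)
  rw [Sym2.eq_swap] at hn4
  obtain rfl := Option.some.inj (hc3.symm.trans ha)
  obtain rfl := Option.some.inj (hc4.symm.trans hb)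
  refine ⟨a, b, hfe, hlf.trans hle, ?_, ?_⟩
  · exact (hu.trans ((hn1.mono subset_rfl le_rfl hle).trans
      (hn3.mono subset_rfl le_rfl (hlf.trans hle)).symm)).mono subset_rfl (by omega) le_rfl
  · exact (hv.trans ((hn2.mono subset_rfl le_rfl hle).trans
      (hn4.mono subset_rfl le_rfl (hlf.trans hle)).symm)).mono subset_rfl (by omega) le_rfl

/-- The representative `s(u', v')` is replaced by the edge `s(u', z)` bought between the vertex `u'`
and the cluster of `v'`. The walk goes through `u'`, `z`, the cluster center and `v'`, with lengths
`3 * r + 1 + r + r + 3 * r`. -/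
lemma finish (h : Good G w r r st) :
    st.finish w rank ⊆ G.edgeSet ∧
      ∀ u v, G.Adj u v → Near w (st.finish w rank) (8 * r + 1) (w s(u, v)) u v := by
  have hss : st.span ⊆ st.finish w rank := Set.subset_union_left
  constructor
  · rintro e (he | ⟨v, c, he⟩)
    exacts [h.span_sub he, h.edges_sub he.1.1]
  intro u v he
  rcases h.rep u v he with h1 | ⟨u', v', hl, hle, hu, hv⟩
  · exact h1.mono hss (by omega) le_rfl
  obtain ⟨c, hc, hn⟩ := h.exists_clusterOf (Sym2.eq_swap ▸ hl : s(v', u') ∈ st.edges)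
  rw [Sym2.eq_swap] at hn
  have hmem : s(u', v') ∈ {f | f ∈ st.edges ∧ ∃ z : V, f = s(u', z) ∧ st.clusterOf z = some c} :=
    ⟨hl, v', rfl, hc⟩
  obtain ⟨f, hf⟩ := exists_mem_lightest (w := w) (rank := rank) ⟨_, hmem⟩
  have hsp : f ∈ st.finish w rank := Or.inr ⟨u', c, hf⟩
  have hlf := (hf.2 _ hmem).weight_le.trans hle
  obtain ⟨⟨hfl, z, rfl, hz⟩, -⟩ := hf
  obtain ⟨c', hc', hn'⟩ := h.exists_clusterOf (Sym2.eq_swap ▸ hfl : s(z, u') ∈ st.edges)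
  rw [Sym2.eq_swap] at hn'
  obtain rfl := Option.some.inj (hc'.symm.trans hz)
  exact (((hu.mono hss le_rfl le_rfl).trans ((Near.of_mem hsp).mono subset_rfl le_rfl hlf)).trans
    ((hn'.mono hss le_rfl hlf).trans ((hn.mono hss le_rfl hle).symm.trans
      (hv.mono hss le_rfl le_rfl).symm))).mono subset_rfl (by omega) le_rfl

end Good

omit [Finite V] in
lemma isSpanner_of_near {S : Set (Sym2 V)} {K : ℕ} {ρ : ℝ} (hK₀ : 0 < K) (hK : (K : ℝ) ≤ ρ)
    (hS : S ⊆ G.edgeSet) (h : ∀ u v, G.Adj u v → Near w S K (w s(u, v)) u v) :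
    IsSpanner G w ρ S := by
  refine ⟨hS, fun u v => ?_⟩
  have key : ∀ {u v : V} (q : G.Walk u v), Near w S K (walkWeight w q) u v := by
    intro u v q
    induction q with
    | nil => exact .refl _
    | @cons a b c hab q ih =>
      obtain ⟨q1, h1⟩ := h a b hab
      obtain ⟨q2, h2⟩ := ih
      refine ⟨q1.append q2, ?_⟩
      have e1 : walkWeight w (q1.append q2) = walkWeight w q1 + walkWeight w q2 := by
        simp [walkWeight, SimpleGraph.Walk.edges_append]
      have e2 : walkWeight w (SimpleGraph.Walk.cons hab q) = w s(a, b) + walkWeight w q := by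
        simp [walkWeight]
      rw [e1, e2, mul_add]
      exact add_le_add h1 h2
  by_cases h0 : Nonempty (G.Walk u v)
  · unfold wdist
    rw [ENNReal.mul_iInf (fun h => absurd h ENNReal.ofReal_ne_top)]
    refine le_iInf fun q => ?_
    obtain ⟨q', hq'⟩ := key q
    refine (iInf_le _ q').trans ?_
    calc ((walkWeight w q' : ℝ≥0) : ℝ≥0∞) ≤ ((K * walkWeight w q : ℝ≥0) : ℝ≥0∞) := by
          exact_mod_cast hq'
      _ = (K : ℝ≥0∞) * (walkWeight w q : ℝ≥0) := by push_cast; rfl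
      _ ≤ _ := by
          gcongr
          rw [← ENNReal.ofReal_natCast]
          exact ENNReal.ofReal_le_ofReal hK
  · rw [not_nonempty_iff] at h0
    -- If `G` has no walk from `u` to `v`, the bound must be `∞`; since `0 * ∞ = 0` in `ℝ≥0∞`, a
    -- positive stretch is essential here.
    have h1 : ENNReal.ofReal ρ ≠ 0 := by
      rw [Ne, ENNReal.ofReal_eq_zero, not_le]
      exact lt_of_lt_of_le (by exact_mod_cast hK₀) hK
    have : wdist G w u v = ⊤ := by simp [wdist]
    rw [this, ENNReal.mul_top h1]
    exact le_top

lemma succ_div_mod_of_dvd {t m : ℕ} (h : t ∣ m + 1) :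
    (m + 1) / t = m / t + 1 ∧ (m + 1) % t = 0 ∧ m % t + 1 = t := by
  refine ⟨Nat.succ_div_of_dvd h, Nat.mod_eq_zero_of_dvd h, ?_⟩
  have h1 := Nat.div_add_mod m t
  have h2 := Nat.mul_div_cancel' h
  rw [Nat.succ_div_of_dvd h, mul_add] at h2
  omega

lemma succ_div_mod_of_not_dvd {t m : ℕ} (h : ¬ t ∣ m + 1) :
    (m + 1) / t = m / t ∧ (m + 1) % t = m % t + 1 := by
  have h0 := Nat.succ_div_of_not_dvd h
  refine ⟨h0, ?_⟩
  have h1 := Nat.div_add_mod m t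
  have h2 := Nat.div_add_mod (m + 1) t
  rw [h0] at h2
  omega

/-- Within an epoch `r` grows by `2 * r₀ + 1` per iteration. The condition on `m` keeps away the
contraction forced at time `T`, which may come before the epoch is complete and is treated in
`good_stateAfter_last`. -/
lemma good_stateAfter {t T : ℕ} (R : ℕ → Finset V) (m : ℕ) (hm : m < T ∨ m = 0) :
    ∃ r₀ r, 2 * r₀ + 1 = (2 * t + 1) ^ (m / t) ∧ r = r₀ + m % t * (2 * r₀ + 1) ∧
      Good G w r₀ r (stateAfter G w rank t T R m) := by
  induction m with
  | zero => exact ⟨0, 0, by simp, by simp, good_init⟩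
  | succ m ih =>
    obtain ⟨r₀, r, h1, h2, hg⟩ := ih (by omega)
    have hg' := hg.grow (R := R m) (rank := rank) (h2 ▸ Nat.le_add_right _ _)
    by_cases ht : t ∣ m + 1
    · obtain ⟨e1, e2, e3⟩ := succ_div_mod_of_dvd ht
      refine ⟨r + 2 * r₀ + 1, r + 2 * r₀ + 1, ?_, by simp [e2], ?_⟩
      · rw [e1, pow_succ, ← h1, h2, (by omega : 2 * t + 1 = 2 * (m % t) + 3)]
        ring
      · rw [stateAfter, if_pos (Or.inl ht)]
        exact hg'.contract (by omega)
    · obtain ⟨e1, e2⟩ := succ_div_mod_of_not_dvd ht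
      refine ⟨r₀, r + 2 * r₀ + 1, by rw [e1, h1], ?_, ?_⟩
      · rw [e2, h2]
        ring
      · rw [stateAfter, if_neg (by omega)]
        exact hg'

lemma good_stateAfter_last {t T : ℕ} (R : ℕ → Finset V) :
    ∃ r, 2 * r + 1 = (2 * t + 1) ^ (T / t) * (2 * (T % t) + 1) ∧
      Good G w r r (stateAfter G w rank t T R T) := by
  cases T with
  | zero => exact ⟨0, by simp, good_init⟩
  | succ m =>
    obtain ⟨r₀, r, h1, h2, hg⟩ :=
      good_stateAfter (G := G) (w := w) (rank := rank) (t := t) R m (Or.inl m.lt_succ_self)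
    have hg' := hg.grow (R := R m) (rank := rank) (h2 ▸ Nat.le_add_right _ _)
    refine ⟨r + 2 * r₀ + 1, ?_, ?_⟩
    · by_cases ht : t ∣ m + 1
      · obtain ⟨e1, e2, e3⟩ := succ_div_mod_of_dvd ht
        rw [e1, e2, pow_succ, ← h1, h2, (by omega : 2 * t + 1 = 2 * (m % t) + 3)]
        ring
      · obtain ⟨e1, e2⟩ := succ_div_mod_of_not_dvd ht
        rw [e1, e2, ← h1, h2]
        ring
    · rw [stateAfter, if_pos (Or.inr rfl)]
      exact hg'.contract (by omega)

lemma isSpanner_output {t T : ℕ} {ρ : ℝ}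
    (hρ : 4 * ((2 * t + 1) ^ (T / t) * (2 * (T % t : ℕ) + 1) : ℝ) ≤ ρ) (R : Fin T → Finset V) :
    IsSpanner G w ρ (output G w rank t T R) := by
  obtain ⟨r, hr, hg⟩ := good_stateAfter_last (G := G) (w := w) (rank := rank) (t := t)
    (fun m => if h : m < T then R ⟨m, h⟩ else ∅)
  obtain ⟨h1, h2⟩ := hg.finish (rank := rank)
  refine isSpanner_of_near (Nat.succ_pos (8 * r)) (le_trans ?_ hρ) h1 h2
  have : (2 * r + 1 : ℝ) = (2 * t + 1) ^ (T / t) * (2 * (T % t : ℕ) + 1) := by exact_mod_cast hr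
  rw [← this]
  push_cast
  linarith

end Stretch

/-! ### Independent sampling -/

section Coins

variable {V : Type*} [Fintype V] {p : ℝ}

/-- Probability of the sample `S`, if each element is sampled independently with probability `p`. -/
noncomputable def coin (p : ℝ) (S : Finset V) : ℝ :=
  p ^ S.card * (1 - p) ^ (Fintype.card V - S.card)

lemma coin_nonneg (h0 : 0 ≤ p) (h1 : p ≤ 1) (S : Finset V) : 0 ≤ coin p S :=
  mul_nonneg (pow_nonneg h0 _) (pow_nonneg (sub_nonneg.2 h1) _)

open Classical in
lemma sum_coin_disjoint (B : Finset V) :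
    ∑ S : Finset V, (if Disjoint S B then coin p S else 0) = (1 - p) ^ B.card := by
  have h1 : (Finset.univ.filter fun S : Finset V => Disjoint S B) = (Bᶜ).powerset := by
    ext S
    simp [Finset.subset_compl_iff_disjoint_right]
  rw [← Finset.sum_filter, h1]
  have h2 : ∀ S ∈ (Bᶜ).powerset,
      coin p S = (1 - p) ^ B.card * (p ^ S.card * (1 - p) ^ ((Bᶜ).card - S.card)) := by
    intro S hS
    have hle := Finset.card_le_card (Finset.mem_powerset.1 hS)
    have hc := Finset.card_add_card_compl B
    rw [coin, mul_left_comm, ← pow_add]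
    congr 2
    omega
  rw [Finset.sum_congr rfl h2, ← Finset.mul_sum, Finset.sum_pow_mul_eq_add_pow]
  simp

lemma sum_coin : ∑ S : Finset V, coin p S = 1 := by
  classical
  simpa using sum_coin_disjoint (p := p) (∅ : Finset V)

open Classical in
lemma sum_coin_mem (v : V) : ∑ S : Finset V, (if v ∈ S then coin p S else 0) = p := by
  have h1 := sum_coin_disjoint (p := p) ({v} : Finset V)
  have h2 := sum_coin (V := V) (p := p)
  have h3 : ∀ S : Finset V, (if v ∈ S then coin p S else 0) =
      coin p S - (if Disjoint S {v} then coin p S else 0) := by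
    intro S
    by_cases h : v ∈ S <;> simp [h]
  rw [Finset.sum_congr rfl fun S _ => h3 S, Finset.sum_sub_distrib, h1, h2]
  simp

/-- Resampling one of several independent samples does not change the expectation. -/
lemma sum_prod_resample {ι α : Type*} [Fintype ι] [DecidableEq ι] [Fintype α] (μ : ι → α → ℝ)
    (i : ι) (hμ : ∑ a, μ i a = 1) (f : (ι → α) → ℝ) :
    ∑ R : ι → α, (∏ j, μ j (R j)) * f R =
      ∑ R : ι → α, (∏ j, μ j (R j)) * ∑ a, μ i a * f (Function.update R i a) := by
  have hprod : ∀ (R : ι → α) (a : α), (∏ j, μ j (Function.update R i a j)) * μ i (R i) =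
      (∏ j, μ j (R j)) * μ i a := by
    intro R a
    rw [Fintype.prod_eq_mul_prod_compl i, Fintype.prod_eq_mul_prod_compl i (fun j => μ j (R j))]
    have : ∏ j ∈ ({i} : Finset ι)ᶜ, μ j (Function.update R i a j) =
        ∏ j ∈ ({i} : Finset ι)ᶜ, μ j (R j) := by
      refine Finset.prod_congr rfl fun j hj => ?_
      rw [Function.update_of_ne (by simpa using hj)]
    rw [this, Function.update_self]
    ring
  -- Exchanging the sample of round `i` with the fresh one is an involution that preserves the
  -- product weight.
  obtain ⟨e, he1, he2⟩ : ∃ e : (ι → α) × α → (ι → α) × α,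
      (∀ x, (e x).1 = Function.update x.1 i x.2) ∧ ∀ x, (e x).2 = x.1 i :=
    ⟨fun x => (Function.update x.1 i x.2, x.1 i), fun _ => rfl, fun _ => rfl⟩
  have he : Function.Involutive e := fun x => Prod.ext (by simp [he1, he2]) (by simp [he1, he2])
  calc ∑ R : ι → α, (∏ j, μ j (R j)) * f R
      = ∑ R : ι → α, ∑ a, (∏ j, μ j (R j)) * f R * μ i a := by
        refine Finset.sum_congr rfl fun R _ => ?_
        rw [← Finset.mul_sum, hμ, mul_one]
    _ = ∑ x : (ι → α) × α, (∏ j, μ j (x.1 j)) * f x.1 * μ i x.2 := by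
        rw [Fintype.sum_prod_type]
    _ = ∑ x : (ι → α) × α, (∏ j, μ j ((e x).1 j)) * f (e x).1 * μ i (e x).2 :=
        (he.bijective.sum_comp fun x => (∏ j, μ j (x.1 j)) * f x.1 * μ i x.2).symm
    _ = ∑ x : (ι → α) × α, (∏ j, μ j (x.1 j)) * (μ i x.2 * f (e x).1) := by
        refine Fintype.sum_congr _ _ fun x => ?_
        have := hprod x.1 x.2
        rw [he2, mul_right_comm, he1, this, mul_assoc]
    _ = _ := by
        rw [Fintype.sum_prod_type]
        refine Finset.sum_congr rfl fun R _ => ?_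
        rw [Finset.mul_sum]
        exact Finset.sum_congr rfl fun a _ => by rw [he1]

open Classical in
/-- The expected number of elements that are sampled in all of the rounds `J`. -/
lemma sum_prod_coin_card {ι : Type*} [Fintype ι] [DecidableEq ι] (q : ι → ℝ) (J : Finset ι) :
    ∑ R : ι → Finset V, (∏ j, coin (q j) (R j)) *
        ((Finset.univ.filter fun v => ∀ j ∈ J, v ∈ R j).card : ℝ) =
      Fintype.card V * ∏ j ∈ J, q j := by
  have h1 : ∀ R : ι → Finset V, (∏ j, coin (q j) (R j)) *
      ((Finset.univ.filter fun v => ∀ j ∈ J, v ∈ R j).card : ℝ) =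
      ∑ v : V, ∏ j, (if j ∈ J → v ∈ R j then coin (q j) (R j) else 0) := by
    intro R
    rw [Finset.card_filter, Nat.cast_sum, Finset.mul_sum]
    refine Fintype.sum_congr _ _ fun v => ?_
    rw [Finset.prod_ite_zero]
    by_cases h : ∀ j ∈ J, v ∈ R j
    · rw [if_pos h, if_pos (by simpa using h)]
      simp
    · rw [if_neg h, if_neg (by simpa using h)]
      simp
  rw [Fintype.sum_congr _ _ h1, Finset.sum_comm]
  have h2 : ∀ v : V, ∑ R : ι → Finset V,
      ∏ j, (if j ∈ J → v ∈ R j then coin (q j) (R j) else 0) = ∏ j ∈ J, q j := by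
    intro v
    -- By independence the sum factors over rounds: a round in `J` contributes `q j`, any other
    -- round contributes `1`.
    rw [← Fintype.prod_sum (fun j (S : Finset V) => if j ∈ J → v ∈ S then coin (q j) S else 0),
      ← Finset.prod_subset (Finset.subset_univ J)]
    · refine Finset.prod_congr rfl fun j hj => ?_
      simpa [hj] using sum_coin_mem v
    · intro j _ hj
      simpa [hj] using sum_coin
  simp [h2]

/-- Listed by increasing key, the exponents are `0, 1, …, s.card - 1`, so this is the finite
geometric sum. -/
lemma sum_pow_card_filter_lt {ι α : Type*} [DecidableEq ι] [LinearOrder α] (key : ι → α)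
    (q : ℝ) (s : Finset ι) (hs : Set.InjOn key s) :
    (1 - q) * ∑ c ∈ s, q ^ (s.filter fun c' => key c' < key c).card = 1 - q ^ s.card := by
  induction s using Finset.induction_on_max_value key with
  | empty => simp
  | insert a s ha hmax ih =>
    have hlt : ∀ c ∈ s, key c < key a := fun c hc => lt_of_le_of_ne (hmax c hc) fun h =>
      ha (hs (Finset.mem_insert_of_mem hc) (Finset.mem_insert_self a s) h ▸ hc)
    rw [Finset.sum_insert ha, Finset.card_insert_of_notMem ha]
    have h1 : (insert a s).filter (fun c' => key c' < key a) = s := by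
      rw [Finset.filter_insert, if_neg (lt_irrefl _), Finset.filter_true_of_mem hlt]
    have h2 : ∀ c ∈ s, q ^ ((insert a s).filter fun c' => key c' < key c).card =
        q ^ (s.filter fun c' => key c' < key c).card := by
      intro c hc
      rw [Finset.filter_insert, if_neg (hlt c hc).le.not_gt]
    rw [h1, Finset.sum_congr rfl h2, mul_add,
      ih (hs.mono (by simp)), pow_succ]
    ring

end Coins

/-! ### Expected number of spanner edges -/

section Size

variable {V : Type*} {G : SimpleGraph V} {w : Sym2 V → ℝ≥0} {rank : Sym2 V → ℕ}

lemma stateAfter_congr {t T m : ℕ} {R R' : ℕ → Finset V} (h : ∀ j < m, R j = R' j) :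
    stateAfter G w rank t T R m = stateAfter G w rank t T R' m := by
  induction m with
  | zero => rfl
  | succ m ih => simp only [stateAfter, ih fun j hj => h j (by omega), h m m.lt_succ_self]

lemma State.mem_of_newClus {st : State V} {R : Finset V} {v x c : V} (hx : st.node v = some x)
    (h : st.newClus w rank R x = some c) : c ∈ R ∧ ∃ u, st.clusterOf u = some c := by
  unfold State.newClus at h
  split_ifs at h with hin
  · obtain ⟨c', hc', h'⟩ := hin
    obtain rfl := Option.some.inj (h'.symm.trans h)
    exact ⟨hc', v, by simp [State.clusterOf, hx, h]⟩
  · obtain ⟨hc, e, ⟨-, -, u, -, -, hu⟩, -⟩ := State.closest_spec h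
    exact ⟨hc, u, hu⟩

/-- No new centers arise: a cluster after an iteration is a sampled cluster from before it, and
contraction keeps the names. -/
lemma mem_of_clusterOf {t T : ℕ} {R : ℕ → Finset V} {m : ℕ} {v c : V}
    (h : (stateAfter G w rank t T R m).clusterOf v = some c) : ∀ j < m, c ∈ R j := by
  induction m generalizing v with
  | zero => simp
  | succ m ih =>
    have h' : ((stateAfter G w rank t T R m).node v).bind
        ((stateAfter G w rank t T R m).newClus w rank (R m)) = some c := by
      rw [stateAfter] at h
      split_ifs at h
      · simpa [State.clusterOf, State.contract, State.grow] using h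
      · exact h
    obtain ⟨x, hx, hc⟩ := Option.bind_eq_some_iff.1 h'
    obtain ⟨hcR, u, hu⟩ := State.mem_of_newClus hx hc
    intro j hj
    rcases Nat.lt_succ_iff_lt_or_eq.1 hj with hj | rfl
    exacts [ih hu j hj, hcR]

/-- Super-nodes change only at contractions, where they are the current clusters. Only the rounds of
completed epochs are claimed, which keeps the bound independent of the coins of the running epoch.
-/
lemma mem_of_node {t T : ℕ} {R : ℕ → Finset V} {m : ℕ} {v x : V}
    (h : (stateAfter G w rank t T R m).node v = some x) : ∀ j < t * (m / t), x ∈ R j := by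
  induction m with
  | zero => simp
  | succ m ih =>
    by_cases hc : t ∣ m + 1 ∨ m + 1 = T
    · intro j hj
      refine mem_of_clusterOf (G := G) (w := w) (rank := rank) (t := t) (T := T) (m := m + 1)
        (v := v) ?_ j (hj.trans_le (Nat.mul_div_le _ _))
      rw [stateAfter, if_pos hc] at h ⊢
      simp only [State.contract, State.clusterOf] at h ⊢
      rw [h]
      rfl
    · rw [stateAfter, if_neg hc] at h
      push Not at hc
      rw [(succ_div_mod_of_not_dvd hc.1).1]
      exact ih h

lemma ncard_lightest_le_one (hrank : Function.Injective rank) (A : Set (Sym2 V)) :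
    (lightest w rank A).ncard ≤ 1 := by
  have hsub : (lightest w rank A).Subsingleton := fun e he f hf => by
    have := le_antisymm (lighter_iff.1 (he.2 f hf.1)) (lighter_iff.1 (hf.2 e he.1))
    exact hrank (congrArg (fun x => (ofLex x).2) this)
  exact (Set.ncard_le_one hsub.finite).2 fun a ha b hb => hsub ha hb

lemma State.edgesTo_unique {st : State V} {x c c' : V} {e : Sym2 V} (h : e ∈ st.edgesTo x c)
    (h' : e ∈ st.edgesTo x c') : c = c' := by
  obtain ⟨-, u, v, rfl, hu, hv⟩ := h
  obtain ⟨-, u', v', he, hu', hv'⟩ := h'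
  rcases Sym2.eq_iff.1 he with ⟨rfl, rfl⟩ | ⟨rfl, rfl⟩
  · exact Option.some.inj (hv.symm.trans hv')
  -- With the orientation reversed, both endpoints lie in the super-node `x`, so `c` and `c'` are
  -- both the cluster of `x`.
  · simp only [State.clusterOf, hu, hu'] at hv hv'
    exact Option.some.inj (hv.symm.trans hv')

variable [Fintype V]

lemma State.exists_closest {st : State V} {R : Finset V} {x c : V} (hc : c ∈ R)
    (h : (st.edgesTo x c).Nonempty) : ∃ c₀, st.closest w rank R x = some c₀ := by
  obtain ⟨f, hf⟩ := h
  obtain ⟨e, ⟨c₀, hc₀, he⟩, hmin⟩ := exists_mem_lightest (w := w) (rank := rank)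
    (A := {e | ∃ c ∈ R, e ∈ st.edgesTo x c}) ⟨f, c, hc, hf⟩
  have : ∃ c, st.IsClosest w rank R x c :=
    ⟨c₀, hc₀, e, he, fun c' hc' f hf => hmin f ⟨c', hc', hf⟩⟩
  exact ⟨_, dif_pos this⟩

open Classical in
/-- The clusters adjacent to `x` to which `x` settles its edges. -/
noncomputable def State.settled (w : Sym2 V → ℝ≥0) (rank : Sym2 V → ℕ) (st : State V)
    (R : Finset V) (x : V) : Finset V :=
  Finset.univ.filter fun c => (st.edgesTo x c).Nonempty ∧ st.Settles w rank R x c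

/-- With the adjacent clusters ordered by lightest edge, `x` settles with `c` only if all earlier
clusters are unsampled. The probabilities of these events are `1, 1 - p, (1 - p) ^ 2, …`, with sum
at most `1 / p`. -/
lemma State.sum_coin_card_settled_le (hrank : Function.Injective rank) (st : State V) (x : V) {p : ℝ} (h0 : 0 < p) (h1 : p ≤ 1) :
    ∑ R : Finset V, coin p R * ((st.settled w rank R x).card : ℝ) ≤ 1 / p := by
  classical
  set A : Finset V := Finset.univ.filter fun c => (st.edgesTo x c).Nonempty with hA
  have hmin : ∀ c ∈ A, ∃ e, e ∈ lightest w rank (st.edgesTo x c) := fun c hc =>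
    exists_mem_lightest (by simpa [hA] using hc)
  have : Nonempty (Sym2 V) := ⟨s(x, x)⟩
  choose! m hm using hmin
  set key : V → ℝ≥0 ×ₗ ℕ := fun c => toLex (w (m c), rank (m c)) with hkey
  have hinj : Set.InjOn key A := by
    intro c hc c' hc' h
    have : m c = m c' := hrank (congrArg (fun x => (ofLex x).2) h)
    exact State.edgesTo_unique (hm c hc).1 (this ▸ (hm c' hc').1)
  -- If an earlier `c'` is sampled, the closest sampled cluster has an edge at most `m c'`, hence
  -- before `m c`. So `c` is not the closest one, nor does it have an edge strictly lighter than all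
  -- edges to it.
  have hdisj : ∀ R : Finset V, ∀ c ∈ A, st.Settles w rank R x c →
      Disjoint R (A.filter fun c' => key c' < key c) := by
    intro R c hc hs
    rw [Finset.disjoint_left]
    intro c' hR hc'
    obtain ⟨hc'A, hlt⟩ := Finset.mem_filter.1 hc'
    obtain ⟨c₀, hc₀⟩ := State.exists_closest (w := w) (rank := rank) (st := st) hR
      ⟨_, (hm c' hc'A).1⟩
    obtain ⟨-, e, he, hemin⟩ := State.closest_spec hc₀
    have hle := hemin c' hR _ (hm c' hc'A).1
    rcases hs.2 c₀ hc₀ with rfl | ⟨f, hf, hflt⟩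
    · exact absurd ((lighter_iff.1 ((hm c hc).2 _ he)).trans (lighter_iff.1 hle)) hlt.not_ge
    · have h2 : w (m c') ≤ w (m c) := (lighter_iff.2 hlt.le).weight_le
      exact absurd (hflt _ he)
        (hle.weight_le.trans (h2.trans ((hm c hc).2 _ hf).weight_le)).not_gt
  have hcard : ∀ R : Finset V, ((st.settled w rank R x).card : ℝ) ≤
      ∑ c ∈ A, if Disjoint R (A.filter fun c' => key c' < key c) then 1 else 0 := by
    intro R
    rw [← Finset.sum_filter, Finset.sum_const, nsmul_eq_mul, mul_one, Nat.cast_le]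
    refine Finset.card_le_card fun c hc => ?_
    simp only [State.settled, Finset.mem_filter, Finset.mem_univ, true_and] at hc
    have hcA : c ∈ A := by simpa [hA] using hc.1
    exact Finset.mem_filter.2 ⟨hcA, hdisj R c hcA hc.2⟩
  have hsum := sum_pow_card_filter_lt key (1 - p) A hinj
  rw [sub_sub_cancel] at hsum
  calc ∑ R : Finset V, coin p R * ((st.settled w rank R x).card : ℝ)
      ≤ ∑ R : Finset V, coin p R *
          ∑ c ∈ A, (if Disjoint R (A.filter fun c' => key c' < key c) then 1 else 0) :=
        Finset.sum_le_sum fun R _ => mul_le_mul_of_nonneg_left (hcard R) (coin_nonneg h0.le h1 R)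
    _ = ∑ c ∈ A, ∑ R : Finset V,
          (if Disjoint R (A.filter fun c' => key c' < key c) then coin p R else 0) := by
        rw [Finset.sum_comm]
        refine Finset.sum_congr rfl fun R _ => ?_
        rw [Finset.mul_sum]
        exact Finset.sum_congr rfl fun c _ => by split_ifs <;> simp
    _ = ∑ c ∈ A, (1 - p) ^ (A.filter fun c' => key c' < key c).card :=
        Finset.sum_congr rfl fun c _ => sum_coin_disjoint _
    _ ≤ 1 / p := by
        rw [le_div_iff₀ h0, mul_comm, hsum]
        have : 0 ≤ (1 - p) ^ A.card := pow_nonneg (sub_nonneg.2 h1) _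
        linarith

lemma State.ncard_span_grow_le (hrank : Function.Injective rank) (st : State V) (R A : Finset V)
    (hA : ∀ v x, st.node v = some x → x ∈ A) :
    (st.grow w rank R).span.ncard ≤
      st.span.ncard + ∑ x ∈ A, (st.settled w rank R x).card := by
  refine (Set.ncard_union_le _ _).trans (Nat.add_le_add_left ?_ _)
  have hsub : {e | ∃ x c, st.Settles w rank R x c ∧ e ∈ lightest w rank (st.edgesTo x c)} ⊆
      ⋃ x ∈ A, ⋃ c ∈ st.settled w rank R x, lightest w rank (st.edgesTo x c) := by
    rintro e ⟨x, c, hs, he⟩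
    obtain ⟨-, u, v, -, hu, -⟩ := he.1
    simp only [Set.mem_iUnion]
    exact ⟨x, hA u x hu, c, by simpa [State.settled] using ⟨⟨e, he.1⟩, hs⟩, he⟩
  refine (Set.ncard_le_ncard hsub (Set.toFinite _)).trans
    ((Finset.set_ncard_biUnion_le _ _).trans (Finset.sum_le_sum fun x _ => ?_))
  refine (Finset.set_ncard_biUnion_le _ _).trans ?_
  exact (Finset.sum_le_sum fun c _ => ncard_lightest_le_one hrank _).trans (by simp)

lemma State.ncard_finish_le (hrank : Function.Injective rank) (st : State V) (A : Finset V)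
    (hA : ∀ v c, st.clusterOf v = some c → c ∈ A) :
    (st.finish w rank).ncard ≤ st.span.ncard + Fintype.card V * A.card := by
  refine (Set.ncard_union_le _ _).trans (Nat.add_le_add_left ?_ _)
  have hsub : {e | ∃ v c : V, e ∈ lightest w rank
      {f | f ∈ st.edges ∧ ∃ u : V, f = s(v, u) ∧ st.clusterOf u = some c}} ⊆
      ⋃ v ∈ (Finset.univ : Finset V), ⋃ c ∈ A, lightest w rank
      {f | f ∈ st.edges ∧ ∃ u : V, f = s(v, u) ∧ st.clusterOf u = some c} := by
    rintro e ⟨v, c, he⟩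
    obtain ⟨-, u, -, hu⟩ := he.1
    simp only [Set.mem_iUnion]
    exact ⟨v, Finset.mem_univ _, c, hA u c hu, he⟩
  refine (Set.ncard_le_ncard hsub (Set.toFinite _)).trans
    ((Finset.set_ncard_biUnion_le _ _).trans ?_)
  refine (Finset.sum_le_card_nsmul _ _ A.card fun v _ => ?_).trans (by simp)
  refine (Finset.set_ncard_biUnion_le _ _).trans ?_
  exact (Finset.sum_le_sum fun c _ => ncard_lightest_le_one hrank _).trans (by simp)

/-- The samples of `T` rounds as a sequence. -/
def extend {T : ℕ} (R : Fin T → Finset V) (m : ℕ) : Finset V :=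
  if h : m < T then R ⟨m, h⟩ else ∅

open Classical in
/-- The elements sampled in each of the first `M` rounds. -/
noncomputable def survivors {T : ℕ} (R : Fin T → Finset V) (M : ℕ) : Finset V :=
  Finset.univ.filter fun v => ∀ j ∈ Finset.univ.filter (fun j : Fin T => (j : ℕ) < M), v ∈ R j

lemma mem_survivors {T M : ℕ} {R : Fin T → Finset V} {v : V}
    (h : ∀ j < M, v ∈ extend R j) : v ∈ survivors R M := by
  simp only [survivors, Finset.mem_filter, Finset.mem_univ, true_and]
  intro j hj
  have := h j hj
  rwa [extend, dif_pos j.2] at this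

lemma ncard_output_le (hrank : Function.Injective rank) (t T : ℕ) (R : Fin T → Finset V) :
    (output G w rank t T R).ncard ≤
      ∑ m : Fin T, ∑ x ∈ survivors R (t * (m / t)),
        ((stateAfter G w rank t T (extend R) m).settled w rank (R m) x).card +
      Fintype.card V * (survivors R T).card := by
  have hspan : ∀ m ≤ T, (stateAfter G w rank t T (extend R) m).span.ncard ≤
      ∑ j ∈ Finset.range m, ∑ x ∈ survivors R (t * (j / t)),
        ((stateAfter G w rank t T (extend R) j).settled w rank (extend R j) x).card := by
    intro m hm
    induction m with
    | zero => simp [stateAfter, State.init]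
    | succ m ih =>
      rw [Finset.sum_range_succ]
      have h1 : (stateAfter G w rank t T (extend R) (m + 1)).span =
          ((stateAfter G w rank t T (extend R) m).grow w rank (extend R m)).span := by
        rw [stateAfter]
        split_ifs <;> rfl
      rw [h1]
      refine (State.ncard_span_grow_le hrank _ _ (survivors R (t * (m / t))) ?_).trans
        (Nat.add_le_add_right (ih (by omega)) _)
      exact fun v x hx => mem_survivors (mem_of_node hx)
  refine (State.ncard_finish_le hrank _ (survivors R T)
    fun v c hc => mem_survivors (mem_of_clusterOf hc)).trans
      (Nat.add_le_add_right ((hspan T le_rfl).trans_eq ?_) _)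
  rw [← Fin.sum_univ_eq_sum_range (fun j => ∑ x ∈ survivors R (t * (j / t)),
        ((stateAfter G w rank t T (extend R) j).settled w rank (extend R j) x).card)]
  refine Finset.sum_congr rfl fun m _ => ?_
  rw [extend, dif_pos m.2]

lemma sum_sampleProb_card_survivors (t : ℕ) {T M : ℕ} (hM : M ≤ T) (p : ℕ → ℝ) :
    ∑ R : Fin T → Finset V, sampleProb t T p R * ((survivors R M).card : ℝ) =
      Fintype.card V * ∏ m ∈ Finset.range M, p (m / t) := by
  classical
  have h := sum_prod_coin_card (V := V) (fun j : Fin T => p (j / t))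
    (Finset.univ.filter fun j : Fin T => (j : ℕ) < M)
  have h2 : ∏ j ∈ Finset.univ.filter (fun j : Fin T => (j : ℕ) < M), p (j / t) =
      ∏ m ∈ Finset.range M, p (m / t) := by
    rw [Finset.prod_filter,
      Fin.prod_univ_eq_prod_range (fun m => if m < M then p (m / t) else 1) T,
      ← Finset.prod_filter]
    congr 1
    ext m
    simp only [Finset.mem_filter, Finset.mem_range]
    omega
  rw [← h2, ← h]
  refine Finset.sum_congr rfl fun R _ => ?_
  unfold survivors sampleProb coin
  congr

/-- The state before round `m` and the survivors of earlier epochs do not depend on the coins of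
round `m`. Resampling that round allows the bound `1 / p` for each possible super-node with
everything else fixed. -/
lemma sum_sampleProb_settled_le (hrank : Function.Injective rank) (t T : ℕ) (p : ℕ → ℝ) (hp : ∀ i, 0 < p i ∧ p i ≤ 1) (m : Fin T) :
    ∑ R : Fin T → Finset V, sampleProb t T p R * ((∑ x ∈ survivors R (t * (m / t)),
        ((stateAfter G w rank t T (extend R) m).settled w rank (R m) x).card : ℕ) : ℝ) ≤
      (Fintype.card V * ∏ j ∈ Finset.range (t * (m / t)), p (j / t)) * (1 / p (m / t)) := by
  classical
  rw [← sum_sampleProb_card_survivors t ((Nat.mul_div_le _ _).trans m.2.le) p, Finset.sum_mul]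
  have hres := sum_prod_resample (fun j : Fin T => coin (V := V) (p (j / t))) m sum_coin
    (fun R => ((∑ x ∈ survivors R (t * (m / t)),
        ((stateAfter G w rank t T (extend R) m).settled w rank (R m) x).card : ℕ) : ℝ))
  refine (hres.trans_le (Finset.sum_le_sum fun R _ => ?_))
  rw [mul_assoc]
  refine mul_le_mul_of_nonneg_left ?_
    (Finset.prod_nonneg fun j _ => coin_nonneg (hp _).1.le (hp _).2 _)
  have hst : ∀ S, stateAfter G w rank t T (extend (Function.update R m S)) m =
      stateAfter G w rank t T (extend R) m := by
    intro S
    refine stateAfter_congr fun j hj => ?_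
    rw [extend, extend, dif_pos (hj.trans m.2), dif_pos (hj.trans m.2), Function.update_of_ne]
    exact fun h => hj.ne (congrArg Fin.val h)
  have hsv : ∀ S, survivors (Function.update R m S) (t * (m / t)) =
      survivors R (t * (m / t)) := by
    intro S
    ext v
    simp only [survivors, Finset.mem_filter, Finset.mem_univ, true_and]
    refine forall₂_congr fun j hj => ?_
    rw [Function.update_of_ne]
    rintro rfl
    exact hj.not_ge (Nat.mul_div_le _ _)
  simp only [hst, hsv, Function.update_self, Nat.cast_sum, Finset.mul_sum]
  rw [Finset.sum_comm]
  refine (Finset.sum_le_card_nsmul _ _ (1 / p (m / t)) fun x _ => ?_).trans (by simp)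
  exact State.sum_coin_card_settled_le hrank _ x (hp _).1 (hp _).2

lemma expectedSize_le (hrank : Function.Injective rank) (t T : ℕ) (p : ℕ → ℝ)
    (hp : ∀ i, 0 < p i ∧ p i ≤ 1) :
    expectedSize G w rank t T p ≤
      ∑ m ∈ Finset.range T,
        (Fintype.card V * ∏ j ∈ Finset.range (t * (m / t)), p (j / t)) * (1 / p (m / t)) +
      Fintype.card V * (Fintype.card V * ∏ j ∈ Finset.range T, p (j / t)) := by
  have hP : ∀ R : Fin T → Finset V, 0 ≤ sampleProb t T p R := fun R =>
    Finset.prod_nonneg fun j _ => coin_nonneg (hp _).1.le (hp _).2 _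
  refine (Finset.sum_le_sum fun R _ => mul_le_mul_of_nonneg_left
    (Nat.cast_le.2 (ncard_output_le hrank t T R)) (hP R)).trans ?_
  simp only [Nat.cast_add, Nat.cast_mul, mul_add, Finset.sum_add_distrib]
  refine add_le_add ?_ (le_of_eq ?_)
  · rw [← Fin.sum_univ_eq_sum_range (fun m => (Fintype.card V *
      ∏ j ∈ Finset.range (t * (m / t)), p (j / t)) * (1 / p (m / t)))]
    simp_rw [Nat.cast_sum (Finset.univ : Finset (Fin T)), Finset.mul_sum (Finset.univ)]
    rw [Finset.sum_comm]
    exact Finset.sum_le_sum fun m _ => sum_sampleProb_settled_le hrank t T p hp m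
  · rw [← sum_sampleProb_card_survivors t le_rfl p, Finset.mul_sum]
    exact Finset.sum_congr rfl fun R _ => by ring

end Size

/-! ### Choice of the parameters and numerical estimates -/

section Parameters

/-- Epoch `i` adds `t * (t + 1) ^ i`, so with the extra `1` each full epoch multiplies the total by
`t + 1`. These sums are the exponents in the product of the sampling probabilities. -/
lemma sum_range_pow_div_add_one {t : ℕ} (ht : 0 < t) (i a : ℕ) (ha : a ≤ t) :
    ∑ m ∈ Finset.range (t * i + a), (t + 1) ^ (m / t) + 1 = (t + 1) ^ i * (1 + a) := by
  have hepoch : ∀ i a, a ≤ t → ∑ x ∈ Finset.range a, (t + 1) ^ ((t * i + x) / t) =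
      (t + 1) ^ i * a := by
    intro i a ha
    rw [Finset.sum_congr rfl (g := fun _ => (t + 1) ^ i)]
    · simp [mul_comm]
    · intro x hx
      rw [Nat.mul_add_div ht, Nat.div_eq_of_lt ((Finset.mem_range.1 hx).trans_le ha), add_zero]
  induction i generalizing a with
  | zero =>
    rw [Finset.sum_range_add, hepoch 0 a ha]
    simp [add_comm]
  | succ i ih =>
    have h1 := ih t le_rfl
    rw [Finset.sum_range_add, hepoch (i + 1) a ha, mul_add_one, add_right_comm, h1, pow_succ]
    ring

lemma sum_range_half_pow_div_le {t : ℕ} (ht : 0 < t) (a : ℕ) :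
    ∑ m ∈ Finset.range (t * a), (1 / 2 : ℝ) ^ (m / t) ≤ 2 * t := by
  have h : ∑ m ∈ Finset.range (t * a), (1 / 2 : ℝ) ^ (m / t) = t * (2 - 2 * (1 / 2 : ℝ) ^ a) := by
    induction a with
    | zero => simp
    | succ a ih =>
      rw [mul_add_one, Finset.sum_range_add, ih,
        Finset.sum_congr rfl (g := fun _ => (1 / 2 : ℝ) ^ a)]
      · simp only [Finset.sum_const, Finset.card_range, nsmul_eq_mul, pow_succ]
        ring
      · intro x hx
        rw [Nat.mul_add_div ht, Nat.div_eq_of_lt (Finset.mem_range.1 hx), add_zero]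
  rw [h]
  have : 0 ≤ (t : ℝ) * (1 / 2 : ℝ) ^ a := by positivity
  linarith

/-- The number of complete epochs. -/
def numEpochs (k t : ℕ) : ℕ := Nat.log (t + 1) k

/-- The number of iterations after the first `numEpochs k t` epochs. -/
def numExtra (k t : ℕ) : ℕ := (k - 1) / (t + 1) ^ numEpochs k t

/-- The total number of growth iterations. -/
def numIter (k t : ℕ) : ℕ := t * numEpochs k t + numExtra k t

/-- The sampling probability in epoch `i`. -/
noncomputable def prob (n k t i : ℕ) : ℝ :=
  1 / 2 * ((n : ℝ) ^ (-(1 / k) : ℝ)) ^ (t + 1) ^ i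

variable {n k t : ℕ}

lemma pow_numEpochs_le (hk : 1 ≤ k) : (t + 1) ^ numEpochs k t ≤ k :=
  Nat.pow_log_le_self _ (by omega)

/-- The stopping condition: `numExtra` is the quotient of `k - 1`, not of `k`, so that it is the
least number of extra iterations with this property. -/
lemma le_pow_mul_numExtra (hk : 1 ≤ k) : k ≤ (t + 1) ^ numEpochs k t * (1 + numExtra k t) := by
  have := Nat.lt_mul_div_succ (k - 1) (pow_pos t.succ_pos (numEpochs k t))
  rw [add_comm 1]
  simp only [numExtra]
  simp only [Nat.succ_eq_add_one] at this
  omega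

lemma numExtra_le (ht : 1 ≤ t) : numExtra k t ≤ t := by
  refine Nat.lt_succ_iff.1 ((Nat.div_lt_iff_lt_mul (pow_pos t.succ_pos _)).2 ?_)
  have : k < (t + 1) ^ (numEpochs k t + 1) := Nat.lt_pow_succ_log_self (by omega) k
  rw [pow_succ, mul_comm] at this
  exact lt_of_le_of_lt (Nat.sub_le _ _) this

/-- The case that needs care is `numExtra k t = t`, where the extra iterations form one more full
epoch and the remainder is `0`; both sides still agree. -/
lemma pow_div_mul_mod_numIter (ht : 1 ≤ t) :
    (2 * t + 1) ^ (numIter k t / t) * (2 * (numIter k t % t) + 1) =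
      (2 * t + 1) ^ numEpochs k t * (2 * numExtra k t + 1) := by
  rw [numIter, Nat.mul_add_div ht, Nat.mul_add_mod]
  rcases (numExtra_le ht).lt_or_eq with h | h
  · rw [Nat.div_eq_of_lt h, Nat.mod_eq_of_lt h, add_zero]
  · rw [h, Nat.div_self ht, Nat.mod_self, pow_succ]
    ring

lemma log_add_one_pos (ht : 1 ≤ t) : 0 < Real.log (t + 1) :=
  Real.log_pos (by have : (1 : ℝ) ≤ t := by exact_mod_cast ht
                   linarith)

lemma numEpochs_le_log_div (hk : 1 ≤ k) (ht : 1 ≤ t) :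
    (numEpochs k t : ℝ) ≤ Real.log k / Real.log (t + 1) := by
  rw [le_div_iff₀ (log_add_one_pos ht), ← Real.log_pow]
  exact Real.log_le_log (by positivity) (by exact_mod_cast pow_numEpochs_le hk)

lemma rpow_log_div (hk : 1 ≤ k) (ht : 1 ≤ t) :
    ((t : ℝ) + 1) ^ (Real.log k / Real.log (t + 1)) = k := by
  have hk' : (0 : ℝ) < k := by exact_mod_cast hk
  rw [Real.rpow_def_of_pos (by positivity), mul_div_cancel₀ _ (log_add_one_pos ht).ne',
    Real.exp_log hk']

lemma numIter_le (hk : 1 ≤ k) (ht : 1 ≤ t) :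
    (numIter k t : ℝ) ≤ 2 * (t * Real.log k / Real.log (t + 1)) := by
  have h1 := numEpochs_le_log_div hk ht
  have ht' : (1 : ℝ) ≤ t := by exact_mod_cast ht
  have h2 : (t : ℝ) * numEpochs k t ≤ t * (Real.log k / Real.log (t + 1)) := by gcongr
  have h3 : (numExtra k t : ℝ) ≤ t * (Real.log k / Real.log (t + 1)) := by
    rcases Nat.eq_zero_or_pos (numEpochs k t) with h0 | h0
    · have hL : Real.log k / Real.log (t + 1) ≤ 1 := by
        rw [div_le_one (log_add_one_pos ht)]
        have : k < t + 1 := by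
          have := Nat.lt_pow_succ_log_self (b := t + 1) (by omega) k
          rw [numEpochs] at h0
          simpa [h0] using this
        exact Real.log_le_log (by exact_mod_cast hk) (by exact_mod_cast this.le)
      -- For `k ≤ t` there is no full epoch and all `k - 1` iterations are extra. Bernoulli's
      -- inequality for the exponent `L = log k / log (t + 1) ≤ 1` gives `k = (1 + t) ^ L ≤ 1 + t *
      -- L`.
      have hb := rpow_one_add_le_one_add_mul_self (s := t) (by linarith)
        ((Nat.cast_nonneg _).trans h1) hL
      rw [add_comm 1 (t : ℝ), rpow_log_div hk ht] at hb
      have : numExtra k t = k - 1 := by simp [numExtra, h0]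
      rw [this, Nat.cast_sub hk]
      push_cast
      linarith
    · have h4 : (1 : ℝ) ≤ numEpochs k t := by exact_mod_cast h0
      have h5 : (numExtra k t : ℝ) ≤ t := by exact_mod_cast numExtra_le ht
      nlinarith
  rw [mul_div_assoc]
  push_cast [numIter]
  linarith

/-- With `L = log k / log (t + 1)` the power of `k` on the right is `(2 * t + 1) ^ L`. The
fractional part of `L` pays for the short last epoch, since `numExtra k t ≤ (t + 1) ^ (L - numEpochs
k t)`; always completing that epoch could cost a further factor of order `t`. -/
lemma pow_numEpochs_mul_numExtra_le (hk : 1 ≤ k) (ht : 1 ≤ t) :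
    (2 * t + 1 : ℝ) ^ numEpochs k t * (2 * numExtra k t + 1) ≤
      3 * (k : ℝ) ^ (Real.log (2 * t + 1) / Real.log (t + 1)) := by
  have hk' : (0 : ℝ) < k := by exact_mod_cast hk
  have ht' : (1 : ℝ) ≤ t := by exact_mod_cast ht
  have h1 := numEpochs_le_log_div hk ht
  have h2 := rpow_log_div hk ht
  set L := Real.log k / Real.log (t + 1) with hL
  have hs : (k : ℝ) ^ (Real.log (2 * t + 1) / Real.log (t + 1)) = (2 * t + 1 : ℝ) ^ L := by
    rw [Real.rpow_def_of_pos hk', Real.rpow_def_of_pos (by positivity), hL]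
    congr 1
    ring
  have hsplit : (2 * t + 1 : ℝ) ^ L =
      (2 * t + 1 : ℝ) ^ numEpochs k t * (2 * t + 1 : ℝ) ^ (L - numEpochs k t) := by
    rw [← Real.rpow_natCast, ← Real.rpow_add (by positivity)]
    congr 1
    ring
  have hone : 1 ≤ (2 * t + 1 : ℝ) ^ (L - numEpochs k t) :=
    Real.one_le_rpow (by linarith) (by linarith)
  have hj : (numExtra k t : ℝ) ≤ (2 * t + 1 : ℝ) ^ (L - numEpochs k t) := by
    calc (numExtra k t : ℝ) ≤ ((k - 1 : ℕ) : ℝ) / ((t + 1) ^ numEpochs k t : ℕ) := Nat.cast_div_le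
      _ ≤ k / ((t : ℝ) + 1) ^ numEpochs k t := by
          push_cast
          gcongr
          omega
      _ = ((t : ℝ) + 1) ^ (L - numEpochs k t) := by
          rw [Real.rpow_sub (by positivity), h2, Real.rpow_natCast]
      _ ≤ _ := Real.rpow_le_rpow (by positivity) (by linarith) (by linarith)
  rw [hs, hsplit, mul_left_comm]
  gcongr
  linarith

lemma rpow_neg_inv_le_one (n k : ℕ) : (n : ℝ) ^ (-(1 / k) : ℝ) ≤ 1 := by
  rcases Nat.eq_zero_or_pos n with rfl | hn
  · rcases Nat.eq_zero_or_pos k with rfl | hk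
    · simp
    · have : (k : ℝ) ≠ 0 := by positivity
      rw [Nat.cast_zero, Real.zero_rpow (by simpa using this)]
      exact zero_le_one
  · exact Real.rpow_le_one_of_one_le_of_nonpos (by exact_mod_cast hn)
      (neg_nonpos.2 (by positivity))

lemma prob_nonneg (i : ℕ) : 0 ≤ prob n k t i := by
  unfold prob
  positivity

lemma prob_le_one (i : ℕ) : prob n k t i ≤ 1 := by
  have := pow_le_one₀ (n := (t + 1) ^ i) (by positivity) (rpow_neg_inv_le_one n k)
  unfold prob
  linarith

lemma prob_pos (hn : 0 < n) (i : ℕ) : 0 < prob n k t i := by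
  unfold prob
  positivity

lemma prod_range_prob (M : ℕ) : ∏ m ∈ Finset.range M, prob n k t (m / t) =
    (1 / 2) ^ M * ((n : ℝ) ^ (-(1 / k) : ℝ)) ^ ∑ m ∈ Finset.range M, (t + 1) ^ (m / t) := by
  simp only [prob]
  rw [Finset.prod_mul_distrib, Finset.prod_pow_eq_pow_sum]
  simp

lemma sum_prod_prob_le (hn : 0 < n) (hk : 1 ≤ k) (ht : 1 ≤ t) :
    ∑ m ∈ Finset.range (numIter k t),
        (n * ∏ j ∈ Finset.range (t * (m / t)), prob n k t (j / t)) * (1 / prob n k t (m / t)) +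
      n * (n * ∏ j ∈ Finset.range (numIter k t), prob n k t (j / t)) ≤
      (4 * t + 1) * (n : ℝ) ^ (1 + 1 / (k : ℝ)) := by
  have hn' : (0 : ℝ) < n := by exact_mod_cast hn
  have hk' : (k : ℝ) ≠ 0 := by positivity
  set b : ℝ := (n : ℝ) ^ (-(1 / k) : ℝ) with hb
  have hb0 : 0 < b := by positivity
  have hb1 : b ≤ 1 := rpow_neg_inv_le_one n k
  have hbk : n * b ^ k = 1 := by
    rw [hb, ← Real.rpow_mul_natCast hn'.le, neg_mul, one_div_mul_cancel hk', Real.rpow_neg_one,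
      mul_inv_cancel₀ hn'.ne']
  have hnb : (n : ℝ) ^ (1 + 1 / (k : ℝ)) = n / b := by
    rw [hb, Real.rpow_neg hn'.le, div_inv_eq_mul, Real.rpow_add hn', Real.rpow_one]
  have hterm : ∀ m, (n * ∏ j ∈ Finset.range (t * (m / t)), prob n k t (j / t)) *
      (1 / prob n k t (m / t)) ≤ (1 / 2) ^ (m / t) * (2 * (n / b)) := by
    intro m
    -- The exponent of `b` in `p (m / t)` exceeds the total `W` of the earlier epochs by exactly
    -- one, so the quotient leaves a single factor `1 / b`.
    have hW := sum_range_pow_div_add_one ht (m / t) 0 (Nat.zero_le _)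
    rw [add_zero, add_zero, mul_one] at hW
    rw [prod_range_prob, prob, ← hb, ← hW, pow_succ]
    set W := ∑ j ∈ Finset.range (t * (m / t)), (t + 1) ^ (j / t)
    have hbW : 0 < b ^ W := by positivity
    have e : n * ((1 / 2) ^ (t * (m / t)) * b ^ W) * (1 / (1 / 2 * (b ^ W * b))) =
        (1 / 2) ^ (t * (m / t)) * (2 * (n / b)) := by
      field_simp
    rw [e]
    exact mul_le_mul_of_nonneg_right (pow_le_pow_of_le_one (by norm_num) (by norm_num)
      (Nat.le_mul_of_pos_left _ ht)) (by positivity)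
  have hsum : ∑ m ∈ Finset.range (numIter k t),
      (n * ∏ j ∈ Finset.range (t * (m / t)), prob n k t (j / t)) * (1 / prob n k t (m / t)) ≤
      4 * t * (n / b) := by
    refine (Finset.sum_le_sum fun m _ => hterm m).trans ?_
    rw [← Finset.sum_mul]
    -- The last epoch is padded to full length; the sum over full epochs is then geometric with
    -- ratio `1/2`.
    have h1 : ∑ m ∈ Finset.range (numIter k t), (1 / 2 : ℝ) ^ (m / t) ≤
        ∑ m ∈ Finset.range (t * (numEpochs k t + 1)), (1 / 2 : ℝ) ^ (m / t) := by
      refine Finset.sum_le_sum_of_subset_of_nonneg (Finset.range_mono ?_)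
        fun _ _ _ => by positivity
      have := numExtra_le (k := k) ht
      rw [numIter, mul_add_one]
      omega
    have h2 := h1.trans (sum_range_half_pow_div_le ht _)
    have h3 : 0 ≤ 2 * ((n : ℝ) / b) := by positivity
    nlinarith [mul_le_mul_of_nonneg_right h2 h3]
  have hlast : n * (n * ∏ j ∈ Finset.range (numIter k t), prob n k t (j / t)) ≤ n / b := by
    have hW := sum_range_pow_div_add_one ht (numEpochs k t) (numExtra k t) (numExtra_le ht)
    have hW' := le_pow_mul_numExtra (t := t) hk
    rw [← hW] at hW'
    rw [prod_range_prob, ← hb]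
    change k ≤ ∑ m ∈ Finset.range (numIter k t), (t + 1) ^ (m / t) + 1 at hW'
    set W := ∑ m ∈ Finset.range (numIter k t), (t + 1) ^ (m / t)
    rw [le_div_iff₀ hb0]
    have h1 : n * b ^ (W + 1) ≤ 1 := by
      rw [← hbk]
      exact mul_le_mul_of_nonneg_left (pow_le_pow_of_le_one hb0.le hb1 hW') hn'.le
    have h2 : (1 / 2 : ℝ) ^ numIter k t ≤ 1 := pow_le_one₀ (by norm_num) (by norm_num)
    calc n * (n * ((1 / 2) ^ numIter k t * b ^ W)) * b
        = n * ((1 / 2) ^ numIter k t * (n * b ^ (W + 1))) := by ring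
      _ ≤ n * (1 * 1) := by gcongr
      _ = n := by ring
  rw [hnb]
  linarith

end Parameters

end EpochSpanner

/-! ### The main theorem -/

theorem mainTheorem3 :
    ∃ C : ℝ, 0 < C ∧ ∀ n k t : ℕ, 1 ≤ k → 1 ≤ t →
      ∃ (T : ℕ) (p : ℕ → ℝ),
        (T : ℝ) ≤ C * (t * Real.log k / Real.log (t + 1)) ∧
        (∀ i, 0 ≤ p i ∧ p i ≤ 1) ∧
        ∀ (V : Type*) [Fintype V], Fintype.card V = n →
          ∀ (G : SimpleGraph V) (w : Sym2 V → ℝ≥0) (rank : Sym2 V → ℕ), Function.Injective rank →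
            (∀ R : Fin T → Finset V,
              EpochSpanner.IsSpanner G w
                (C * (k : ℝ) ^ (Real.log (2 * t + 1) / Real.log (t + 1)))
                (EpochSpanner.output G w rank t T R)) ∧
            EpochSpanner.expectedSize G w rank t T p ≤
              C * ((n : ℝ) ^ (1 + 1 / (k : ℝ)) * (t + Real.log k)) := by
  -- `12 = 4 * 3`: the stretch is at most `4 * (2 * r + 1)`, and `2 * r + 1` is at most three times
  -- the power of `k`. The other two bounds need less.
  refine ⟨12, by norm_num, fun n k t hk ht =>
    ⟨EpochSpanner.numIter k t, EpochSpanner.prob n k t, ?_,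
      fun i => ⟨EpochSpanner.prob_nonneg i, EpochSpanner.prob_le_one i⟩, ?_⟩⟩
  · have h := EpochSpanner.numIter_le hk ht
    have h0 := (Nat.cast_nonneg (α := ℝ) _).trans h
    linarith
  intro V _ hV G w rank hrank
  constructor
  · refine fun R => EpochSpanner.isSpanner_output ?_ R
    have h1 : ((2 * t + 1) ^ (EpochSpanner.numIter k t / t) *
        (2 * (EpochSpanner.numIter k t % t : ℕ) + 1) : ℝ) =
        (2 * t + 1) ^ EpochSpanner.numEpochs k t * (2 * EpochSpanner.numExtra k t + 1) := by
      exact_mod_cast EpochSpanner.pow_div_mul_mod_numIter ht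
    have h2 := EpochSpanner.pow_numEpochs_mul_numExtra_le hk ht
    rw [h1]
    linarith
  · have hlog : 0 ≤ Real.log k := Real.log_natCast_nonneg k
    have ht' : (1 : ℝ) ≤ t := by exact_mod_cast ht
    have hpow : 0 ≤ (n : ℝ) ^ (1 + 1 / (k : ℝ)) := by positivity
    -- For `n = 0` the sampling probabilities vanish and the bound `1 / p` is unavailable, but there
    -- are no edges at all.
    rcases Nat.eq_zero_or_pos n with hn | hn
    · have hemp : IsEmpty V := Fintype.card_eq_zero_iff.1 (hV.trans hn)
      have h0 : EpochSpanner.expectedSize G w rank t (EpochSpanner.numIter k t)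
          (EpochSpanner.prob n k t) = 0 := by
        refine Finset.sum_eq_zero fun R _ => ?_
        rw [Set.eq_empty_of_isEmpty (EpochSpanner.output _ _ _ _ _ _)]
        simp
      rw [h0]
      positivity
    · have h1 := EpochSpanner.expectedSize_le (G := G) (w := w) hrank t
        (EpochSpanner.numIter k t) (EpochSpanner.prob n k t)
        fun i => ⟨EpochSpanner.prob_pos hn i, EpochSpanner.prob_le_one i⟩
      rw [hV] at h1
      refine h1.trans ((EpochSpanner.sum_prod_prob_le hn hk ht).trans ?_)
      rw [mul_left_comm, mul_comm]
      exact mul_le_mul_of_nonneg_left (by linarith) hpow
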